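/- Let $n\ge 2$ and let $A=[a_{ij}]\in\mathbb{C}^{n\times n}$ have spectrum $\sigma(A)$. Put $r_i=\sum_{j\ne i}|a_{ij}|$ and $c_i=\sum_{j\ne i}|a_{ji}|$ for $i=1,\dots,n$. Let $\alpha,\beta\in[0,1]$, and read $0^0=1$ in all powers. Define the following sets of $z\in\mathbb{C}$, where always $i\neq j$ when two indices occur. For $k=1,2,3,4$ let $\Gamma_i^{(k)}=\{z:|z-a_{ii}|\le\rho_i^{(k)}\}$, with (1) $\rho_i=r_i$; (2) $\rho_i=c_i$; (3) $\rho_i=r_i^{\alpha}c_i^{1-\alpha}$; (4) $\rho_i=\alpha r_i+(1-\alpha)c_i$. For $k=5,\dots,15$ let $\Gamma_{i,j}^{(k)}=\{z:|z-a_{ii}||z-a_{jj}|\le\rho_{i,j}^{(k)}\}$, with (5) $\rho_{i,j}=r_ir_j$; (6) $c_ic_j$; (7) $r_ic_j$; (8) $(r_ir_j)^{\alpha}(c_ic_j)^{1-\alpha}$; (9) $(r_ic_j)^{\alpha}(r_jc_i)^{1-\alpha}$; (10) $\alpha r_ir_j+(1-\alpha)c_ic_j$; (11) $\alpha r_ic_j+(1-\alpha)r_jc_i$;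 (12) $[\alpha r_i+(1-\alpha)c_i][\alpha r_j+(1-\alpha)c_j]$; (13) $[\alpha r_i+(1-\alpha)c_i][\alpha c_j+(1-\alpha)r_j]$; (14) $[\alpha r_i+(1-\alpha)c_j][\alpha r_j+(1-\alpha)c_i]$; (15) $[\alpha r_i+(1-\alpha)r_j][\alpha c_j+(1-\alpha)c_i]$. For $k=16,\dots,31$ let $\Gamma_{i,j}^{(k)}=\{z:|z-a_{ii}|^{\alpha}|z-a_{jj}|^{1-\alpha}\le\rho_{i,j}^{(k)}\}$, with (16) $\rho_{i,j}=r_i^{\alpha}r_j^{1-\alpha}$; (17) $c_i^{\alpha}c_j^{1-\alpha}$; (18) $r_i^{\alpha}c_j^{1-\alpha}$; (19) $\alpha r_i+(1-\alpha)r_j$; (20) $\alpha c_i+(1-\alpha)c_j$; (21) $\alpha r_i+(1-\alpha)c_j$; (22) $(r_i^{\beta}c_i^{1-\beta})^{\alpha}(r_j^{\beta}c_j^{1-\beta})^{1-\alpha}$; (23) $(r_i^{\beta}c_i^{1-\beta})^{\alpha}(c_j^{\beta}r_j^{1-\beta})^{1-\alpha}$; (24) $\beta r_i^{\alpha}r_j^{1-\alpha}+(1-\beta)c_i^{\alpha}c_j^{1-\alpha}$;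 (25) $\beta r_i^{\alpha}c_j^{1-\alpha}+(1-\beta)c_i^{\alpha}r_j^{1-\alpha}$; (26) $\alpha r_i^{\beta}c_i^{1-\beta}+(1-\alpha)r_j^{\beta}c_j^{1-\beta}$; (27) $\alpha r_i^{\beta}c_i^{1-\beta}+(1-\alpha)c_j^{\beta}r_j^{1-\beta}$; (28) $[\beta r_i+(1-\beta)c_i]^{\alpha}[\beta r_j+(1-\beta)c_j]^{1-\alpha}$; (29) $[\beta r_i+(1-\beta)c_i]^{\alpha}[\beta c_j+(1-\beta)r_j]^{1-\alpha}$; (30) $[\alpha r_i+(1-\alpha)r_j]^{\beta}[\alpha c_i+(1-\alpha)c_j]^{1-\beta}$; (31) $[\alpha r_i+(1-\alpha)c_j]^{\beta}[\alpha c_i+(1-\alpha)r_j]^{1-\beta}$. Let $\Gamma^{(k)}=\bigcup_i\Gamma_i^{(k)}$ for $k\le4$ and $\Gamma^{(k)}=\bigcup_{i\ne j}\Gamma_{i,j}^{(k)}$ for $k\ge5$; these sets depend on those of the parameters $\alpha,\beta$ that occur in their definition. Let $\mathbf{\Gamma}^{(k)}(A,r,c)$ be the intersection of $\Gamma^{(k)}$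 over all values in $[0,1]$ of the parameters that occur in it. **Theorem.** Let $A$ be as above. (a) For all $\alpha,\beta\in[0,1]$ and every $\lambda\in\sigma(A)$: for each $k=1,2,3,4$ there is an index $i$ with $\lambda\in\Gamma_i^{(k)}$, and for each $k=5,\dots,31$ there are indices $i\neq j$ with $\lambda\in\Gamma_{i,j}^{(k)}$. (b) For each $k=1,\dots,31$ and all $\alpha,\beta\in[0,1]$, $\sigma(A)\subseteq\mathbf{\Gamma}^{(k)}(A,r,c)\subseteq\Gamma^{(k)}$. (c) $\sigma(A)\subseteq\bigcap_{k=1}^{31}\mathbf{\Gamma}^{(k)}(A,r,c)=\mathbf{\Gamma}^{(22)}(A,r,c)\cap\mathbf{\Gamma}^{(23)}(A,r,c)$. The analogue also holds: suppose that the indices $1,\dots,n$ are distributed over an ordered list of nonempty blocks that exhibits a Frobenius normal form of $A$, that is, after listing the indices block by block $A$ is block upper triangular with irreducible diagonal blocks (every matrix of order one counting as irreducible). Let $\tilde r_i$ and $\tilde c_i$ be the deleted absolute row and column sums, at the index $i$, of the diagonal block containing $i$. Then (a), (b) and (c) hold with $r,c$ replaced by $\tilde r,\tilde c$ throughout. (The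 kind $k=1$ is Geršgorin's theorem, $k=3$ and $k=8$ are results of Ostrowski, $k=5$ and $k=6$ are Brauer's ovals of Cassini, and $k=7$ is the oval $|z-a_{ii}||z-a_{jj}|\le r_ic_j$.) -/

import Mathlib

noncomputable section

namespace EigenInclusion

variable {n : ℕ}

/-- The `i`-th deleted absolute row sum `r_i(A) = ∑_{j ≠ i} |a_ij|`. -/
def rowSum (A : Matrix (Fin n) (Fin n) ℂ) (i : Fin n) : ℝ :=
  ∑ j ∈ Finset.univ.erase i, ‖A i j‖

/-- The `i`-th deleted absolute column sum `c_i(A) = ∑_{j ≠ i} |a_ji|`. -/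
def colSum (A : Matrix (Fin n) (Fin n) ℂ) (i : Fin n) : ℝ :=
  ∑ j ∈ Finset.univ.erase i, ‖A j i‖

/-- The radii of the disks, kinds `k = 1, 2, 3, 4`, built from two vectors `r`, `c`.
Other values of `k` are never used. Powers are real powers, with `0 ^ 0 = 1`. -/
def diskRadius (k : ℕ) (r c : Fin n → ℝ) (α : ℝ) (i : Fin n) : ℝ :=
  match k with
  | 1 => r i
  | 2 => c i
  | 3 => r i ^ α * c i ^ (1 - α)
  | 4 => α * r i + (1 - α) * c i
  | _ => 0

/-- The right-hand sides of the ovals, kinds `k = 5, …, 31`, built from two vectors `r`, `c`.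
Other values of `k` are never used. Powers are real powers, with `0 ^ 0 = 1`. -/
def ovalRadius (k : ℕ) (r c : Fin n → ℝ) (α β : ℝ) (i j : Fin n) : ℝ :=
  match k with
  | 5 => r i * r j
  | 6 => c i * c j
  | 7 => r i * c j
  | 8 => (r i * r j) ^ α * (c i * c j) ^ (1 - α)
  | 9 => (r i * c j) ^ α * (r j * c i) ^ (1 - α)
  | 10 => α * (r i * r j) + (1 - α) * (c i * c j)
  | 11 => α * (r i * c j) + (1 - α) * (r j * c i)
  | 12 => (α * r i + (1 - α) * c i) * (α * r j + (1 - α) * c j)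
  | 13 => (α * r i + (1 - α) * c i) * (α * c j + (1 - α) * r j)
  | 14 => (α * r i + (1 - α) * c j) * (α * r j + (1 - α) * c i)
  | 15 => (α * r i + (1 - α) * r j) * (α * c j + (1 - α) * c i)
  | 16 => r i ^ α * r j ^ (1 - α)
  | 17 => c i ^ α * c j ^ (1 - α)
  | 18 => r i ^ α * c j ^ (1 - α)
  | 19 => α * r i + (1 - α) * r j
  | 20 => α * c i + (1 - α) * c j
  | 21 => α * r i + (1 - α) * c j
  | 22 => (r i ^ β * c i ^ (1 - β)) ^ α * (r j ^ β * c j ^ (1 - β)) ^ (1 - α)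
  | 23 => (r i ^ β * c i ^ (1 - β)) ^ α * (c j ^ β * r j ^ (1 - β)) ^ (1 - α)
  | 24 => β * (r i ^ α * r j ^ (1 - α)) + (1 - β) * (c i ^ α * c j ^ (1 - α))
  | 25 => β * (r i ^ α * c j ^ (1 - α)) + (1 - β) * (c i ^ α * r j ^ (1 - α))
  | 26 => α * (r i ^ β * c i ^ (1 - β)) + (1 - α) * (r j ^ β * c j ^ (1 - β))
  | 27 => α * (r i ^ β * c i ^ (1 - β)) + (1 - α) * (c j ^ β * r j ^ (1 - β))
  | 28 => (β * r i + (1 - β) * c i) ^ α * (β * r j + (1 - β) * c j) ^ (1 - α)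
  | 29 => (β * r i + (1 - β) * c i) ^ α * (β * c j + (1 - β) * r j) ^ (1 - α)
  | 30 => (α * r i + (1 - α) * r j) ^ β * (α * c i + (1 - α) * c j) ^ (1 - β)
  | 31 => (α * r i + (1 - α) * c j) ^ β * (α * c i + (1 - α) * r j) ^ (1 - β)
  | _ => 0

/-- The disk `Γ_i^(k)`, `k = 1, …, 4`. -/
def disk (k : ℕ) (A : Matrix (Fin n) (Fin n) ℂ) (r c : Fin n → ℝ) (α : ℝ) (i : Fin n) : Set ℂ :=
  {z | ‖z - A i i‖ ≤ diskRadius k r c α i}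

/-- The oval `Γ_{i,j}^(k)`, `k = 5, …, 31`. -/
def oval (k : ℕ) (A : Matrix (Fin n) (Fin n) ℂ) (r c : Fin n → ℝ) (α β : ℝ) (i j : Fin n) :
    Set ℂ :=
  if k ≤ 15 then
    {z | ‖z - A i i‖ * ‖z - A j j‖ ≤ ovalRadius k r c α β i j}
  else
    {z | ‖z - A i i‖ ^ α * ‖z - A j j‖ ^ (1 - α) ≤ ovalRadius k r c α β i j}

/-- The set `Γ^(k)` for fixed `α`, `β`: the union of all the disks, or of all the ovals with
`i ≠ j`, of the kind `k`. -/
def region (k : ℕ) (A : Matrix (Fin n) (Fin n) ℂ) (r c : Fin n → ℝ) (α β : ℝ) : Set ℂ :=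
  if k ≤ 4 then ⋃ i : Fin n, disk k A r c α i
  else ⋃ (i : Fin n) (j : Fin n) (_ : i ≠ j), oval k A r c α β i j

/-- The bold set `𝚪^(k)`: the intersection of the sets `Γ^(k)` over all the parameters in `[0,1]`.
For the kinds whose formula does not contain `β`, or contains neither `α` nor `β`, intersecting
over the absent parameters changes nothing. -/
def boldRegion (k : ℕ) (A : Matrix (Fin n) (Fin n) ℂ) (r c : Fin n → ℝ) : Set ℂ :=
  ⋂ α ∈ Set.Icc (0 : ℝ) 1, ⋂ β ∈ Set.Icc (0 : ℝ) 1, region k A r c α β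

/-- A matrix is reducible if, after listing the indices of a suitable nonempty proper subset `S`
first (the same permutation for rows and columns), its lower left block vanishes. -/
def Reducible {m : Type*} (M : Matrix m m ℂ) : Prop :=
  ∃ S : Set m, S.Nonempty ∧ Sᶜ.Nonempty ∧ ∀ i ∉ S, ∀ j ∈ S, M i j = 0

/-- `b` sorts the indices into `l` nonempty blocks exhibiting a Frobenius normal form of `A`:
with the indices listed block by block, `A` is block upper triangular, with irreducible diagonal
blocks (every matrix of order one is irreducible, the zero matrix included). -/
structure IsFrobeniusForm {l : ℕ} (A : Matrix (Fin n) (Fin n) ℂ) (b : Fin n → Fin l) : Prop where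
  surjective : Function.Surjective b
  blockTriangular : A.BlockTriangular b
  irreducible : ∀ k : Fin l, ¬ Reducible (A.toSquareBlock b k)

/-- The deleted absolute row sum `r̃_i(A)` of the diagonal block that contains the index `i`. -/
def blockRowSum {l : ℕ} (A : Matrix (Fin n) (Fin n) ℂ) (b : Fin n → Fin l) (i : Fin n) : ℝ :=
  ∑ j with j ≠ i ∧ b j = b i, ‖A i j‖

/-- The deleted absolute column sum `c̃_i(A)` of the diagonal block that contains the index `i`. -/
def blockColSum {l : ℕ} (A : Matrix (Fin n) (Fin n) ℂ) (b : Fin n → Fin l) (i : Fin n) : ℝ :=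
  ∑ j with j ≠ i ∧ b j = b i, ‖A j i‖

end EigenInclusion

end

namespace EigenInclusion

open Finset

/-! Everything rests on the Ostrowski–Brauer ovals (kind 8). If `z` is an eigenvalue, `z - A` has a
kernel vector `v`. Hölder's inequality with weights `|a_ij|` splits each row of the kernel equation
into a power of the row sum and a sum in `|v_j| ^ p`. Thus `w = |v| ^ p` satisfies row inequalities
whose matrix has the entries `|a_ij|`, and testing them against a suitable left vector brings in the
column sums (`exists_mul_le_mul_of_row_le`, `exists_diag_mul_le`). Kinds 22 and 23 follow by
contradiction: if the inequality failed for `(i, j)` and for `(j, i)`, the product of the two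
failures would contradict kind 8 (`exists_geom_le`, `exists_geom_cross_le`). Conversely, 22 and 23
yield every other kind, at a single point `z`, by specializing `α` or `β` to `0`, `1/2`, `1` and
applying the weighted AM-GM inequality (`mem_of_mem_geom`). This gives both the inclusions and the
equality of intersections. In the block version, some diagonal block of `z - A` is singular, and the
same estimate applies to that block. -/

/-- Brauer's column estimate for a nonnegative vector that satisfies the row inequalities. -/
lemma exists_mul_le_mul_of_row_le {m : Type*} [Fintype m] [DecidableEq m] [Nontrivial m]
    {a : m → m → ℝ} (ha : ∀ i j, 0 ≤ a i j) {D w C : m → ℝ} (hD : ∀ i, 0 ≤ D i)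
    (hw : ∀ i, 0 ≤ w i) (hw0 : ∃ i, w i ≠ 0)
    (hrow : ∀ i, D i * w i ≤ ∑ j ∈ univ.erase i, a i j * w j)
    (hC : ∀ j, ∑ i ∈ univ.erase j, a i j ≤ C j) :
    ∃ i j, i ≠ j ∧ D i * D j ≤ C i * C j := by
  by_contra! hcon
  have hC0 : ∀ j, 0 ≤ C j := fun j => (sum_nonneg fun i _ => ha i j).trans (hC j)
  have hDpos : ∀ i, 0 < D i := fun i => by
    obtain ⟨j, hj⟩ := exists_ne i
    have h1 := hcon i j hj.symm
    have h2 := mul_nonneg (hC0 i) (hC0 j)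
    refine lt_of_le_of_ne (hD i) fun h => ?_
    rw [← h] at h1
    linarith
  -- Pairing the row inequalities with a left vector `y ≥ 0` and exchanging sums turns them into a
  -- statement about columns. The aim is a `y` making every bracket nonnegative, and enough of them
  -- positive to force `w = 0`.
  have hweight : ∀ y : m → ℝ, (∀ i, 0 ≤ y i) →
      ∑ j, w j * (y j * D j - ∑ i ∈ univ.erase j, y i * a i j) ≤ 0 := fun y hy => by
    have h1 : ∑ i, y i * (D i * w i) ≤ ∑ i, y i * ∑ j ∈ univ.erase i, a i j * w j :=
      sum_le_sum fun i _ => mul_le_mul_of_nonneg_left (hrow i) (hy i)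
    have h2 : ∑ i, y i * ∑ j ∈ univ.erase i, a i j * w j
        = ∑ j, w j * ∑ i ∈ univ.erase j, y i * a i j := by
      simp only [mul_sum]
      rw [sum_comm' (t' := univ) (s' := fun j => univ.erase j) (by simp [eq_comm])]
      exact sum_congr rfl fun j _ => sum_congr rfl fun i _ => by ring
    have h3 : ∑ j, w j * (y j * D j) = ∑ i, y i * (D i * w i) :=
      sum_congr rfl fun i _ => by ring
    simp only [mul_sub, sum_sub_distrib]
    linarith
  by_cases hall : ∀ j, C j < D j
  · have h := hweight (fun _ => 1) fun _ => zero_le_one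
    obtain ⟨i, hi⟩ := hw0
    refine absurd h (not_le.mpr ?_)
    have hterm : ∀ j, 0 < 1 * D j - ∑ i ∈ univ.erase j, 1 * a i j := fun j => by
      simp only [one_mul]
      linarith [hC j, hall j]
    exact sum_pos' (fun j _ => mul_nonneg (hw j) (hterm j).le)
      ⟨i, mem_univ i, mul_pos (lt_of_le_of_ne (hw i) hi.symm) (hterm i)⟩
  · push Not at hall
    obtain ⟨p, hp⟩ := hall
    -- The weight `t` at `p`, and `1` elsewhere, makes the bracket at `p` nonnegative. At `q ≠ p`
    -- the bracket is at least `D q - t * C q`, positive because `C p * C q < D p * D q`.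
    set t := C p / D p with ht
    have ht1 : 1 ≤ t := (one_le_div (hDpos p)).mpr hp
    have htp : t * D p = C p := div_mul_cancel₀ _ (hDpos p).ne'
    set y : m → ℝ := fun i => if i = p then t else 1 with hy
    have hyt : ∀ i, y i ≤ t := fun i => by simp only [hy]; split_ifs <;> linarith
    have hy0 : ∀ i, 0 ≤ y i := fun i => by simp only [hy]; split_ifs <;> linarith
    have htermp : 0 ≤ y p * D p - ∑ i ∈ univ.erase p, y i * a i p := by
      have : ∑ i ∈ univ.erase p, y i * a i p = ∑ i ∈ univ.erase p, a i p :=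
        sum_congr rfl fun i hi => by simp [hy, ne_of_mem_erase hi]
      rw [this]
      simp only [hy, if_true]
      linarith [hC p]
    have hterm : ∀ q, q ≠ p → 0 < y q * D q - ∑ i ∈ univ.erase q, y i * a i q := fun q hq => by
      have h1 : ∑ i ∈ univ.erase q, y i * a i q ≤ t * C q :=
        calc _ ≤ ∑ i ∈ univ.erase q, t * a i q :=
              sum_le_sum fun i _ => mul_le_mul_of_nonneg_right (hyt i) (ha i q)
          _ = t * ∑ i ∈ univ.erase q, a i q := (mul_sum ..).symm
          _ ≤ _ := mul_le_mul_of_nonneg_left (hC q) (by linarith)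
      have h2 : t * C q < D q := by
        rw [ht, div_mul_eq_mul_div, div_lt_iff₀ (hDpos p)]
        exact hcon q p hq |>.trans_le' (mul_comm _ _).le
      simp only [hy, if_neg hq, one_mul] at h1 ⊢
      linarith
    have hnn : ∀ j ∈ univ, 0 ≤ w j * (y j * D j - ∑ i ∈ univ.erase j, y i * a i j) := fun j _ => by
      refine mul_nonneg (hw j) ?_
      by_cases hj : j = p
      · rw [hj]; exact htermp
      · exact (hterm j hj).le
    have hzero := (sum_eq_zero_iff_of_nonneg hnn).mp (le_antisymm (hweight y hy0) (sum_nonneg hnn))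
    have hwq : ∀ q, q ≠ p → w q = 0 := fun q hq =>
      (mul_eq_zero.mp (hzero q (mem_univ q))).resolve_right (hterm q hq).ne'
    -- Only `w p` can still be nonzero, but row `p` bounds it by the other, vanishing entries.
    have hrowp := hrow p
    rw [sum_eq_zero fun j hj => by rw [hwq j (ne_of_mem_erase hj), mul_zero]] at hrowp
    have hwp : w p = 0 := le_antisymm (nonpos_of_mul_nonpos_right hrowp (hDpos p)) (hw p)
    obtain ⟨i, hi⟩ := hw0
    by_cases h : i = p
    · exact hi (h ▸ hwp)
    · exact hi (hwq i h)

/-! ### Ostrowski–Brauer ovals for singular matrices. -/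

section Ostrowski

variable {m : Type*} [Fintype m] [DecidableEq m] [Nontrivial m]

/-- Positivity of `R` permits division by `R i ^ γ`, and `γ < 1` makes the Hölder exponent `1 / (1 -
γ)` finite. -/
lemma exists_diag_mul_le_of_pos {M : Matrix m m ℂ} (hM : M.det = 0) {R C : m → ℝ}
    (hR0 : ∀ i, 0 < R i) (hR : ∀ i, ∑ j ∈ univ.erase i, ‖M i j‖ ≤ R i)
    (hC : ∀ j, ∑ i ∈ univ.erase j, ‖M i j‖ ≤ C j) {γ : ℝ} (hγ0 : 0 ≤ γ) (hγ1 : γ < 1) :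
    ∃ i j, i ≠ j ∧ ‖M i i‖ * ‖M j j‖ ≤ (R i * R j) ^ γ * (C i * C j) ^ (1 - γ) := by
  obtain ⟨v, hv0, hv⟩ := Matrix.exists_mulVec_eq_zero_iff.mpr hM
  have h1γ : 0 < 1 - γ := by linarith
  set p := (1 - γ)⁻¹ with hp
  have hp1 : 1 ≤ p := (one_le_inv₀ h1γ).mpr (by linarith)
  have hp0 : 0 < p := by linarith
  have hRγ : ∀ i, 0 < R i ^ γ := fun i => Real.rpow_pos_of_pos (hR0 i) _
  have hrow : ∀ i, ‖M i i‖ * ‖v i‖ ≤ ∑ j ∈ univ.erase i, ‖M i j‖ * ‖v j‖ := fun i => by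
    have h : ∑ j, M i j * v j = 0 := congrFun hv i
    rw [← add_sum_erase _ _ (mem_univ i), add_eq_zero_iff_eq_neg] at h
    rw [← norm_mul, h, norm_neg]
    exact (norm_sum_le _ _).trans (sum_le_sum fun j _ => (norm_mul _ _).le)
  -- Hölder with weights `‖M i j‖`, whose total mass is at most `R i`.
  have hholder : ∀ i, ‖M i i‖ * ‖v i‖
      ≤ R i ^ γ * (∑ j ∈ univ.erase i, ‖M i j‖ * ‖v j‖ ^ p) ^ (1 - γ) := fun i => by
    refine (hrow i).trans ((Real.inner_le_weight_mul_Lp_of_nonneg _ hp1 _ _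
      (fun j => norm_nonneg _) fun j => norm_nonneg _).trans ?_)
    rw [hp, inv_inv, sub_sub_cancel]
    refine mul_le_mul_of_nonneg_right (Real.rpow_le_rpow (sum_nonneg fun j _ => norm_nonneg _)
      (hR i) hγ0) (Real.rpow_nonneg (sum_nonneg fun j _ => ?_) _)
    positivity
  have hpow : ∀ x : ℝ, 0 ≤ x → (x ^ p) ^ (1 - γ) = x := fun x hx => by
    rw [← Real.rpow_mul hx, hp, inv_mul_cancel₀ h1γ.ne', Real.rpow_one]
  have hD0 : ∀ i, 0 ≤ ‖M i i‖ / R i ^ γ := fun i => div_nonneg (norm_nonneg _) (hRγ i).le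
  obtain ⟨i, j, hij, h⟩ := exists_mul_le_mul_of_row_le (a := fun i j => ‖M i j‖)
    (fun _ _ => norm_nonneg _) (D := fun i => (‖M i i‖ / R i ^ γ) ^ p)
    (w := fun i => ‖v i‖ ^ p) (C := C) (fun i => Real.rpow_nonneg (hD0 i) _)
    (fun i => by positivity)
    (by
      obtain ⟨i, hi⟩ := Function.ne_iff.mp hv0
      exact ⟨i, (Real.rpow_pos_of_pos (norm_pos_iff.mpr hi) _).ne'⟩)
    (fun i => by
      have hS : 0 ≤ ∑ j ∈ univ.erase i, ‖M i j‖ * ‖v j‖ ^ p :=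
        sum_nonneg fun j _ => by positivity
      rw [← Real.mul_rpow (hD0 i) (norm_nonneg _),
        ← Real.le_rpow_inv_iff_of_pos (mul_nonneg (hD0 i) (norm_nonneg _)) hS hp0, hp, inv_inv,
        div_mul_eq_mul_div, div_le_iff₀ (hRγ i), mul_comm _ (R i ^ γ)]
      exact hholder i) hC
  refine ⟨i, j, hij, ?_⟩
  have h' := Real.rpow_le_rpow (by have := hD0 i; have := hD0 j; positivity) h h1γ.le
  rw [← Real.mul_rpow (hD0 i) (hD0 j), hpow _ (mul_nonneg (hD0 i) (hD0 j)), div_mul_div_comm,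
    div_le_iff₀ (mul_pos (hRγ i) (hRγ j)), ← Real.mul_rpow (hR0 i).le (hR0 j).le] at h'
  exact h'.trans_eq (mul_comm _ _)

/-- The Ostrowski–Brauer theorem: the ovals of kind `8`, for arbitrary bounds of the deleted
row and column sums of a singular matrix. -/
theorem exists_diag_mul_le {M : Matrix m m ℂ} (hM : M.det = 0) {R C : m → ℝ}
    (hR : ∀ i, ∑ j ∈ univ.erase i, ‖M i j‖ ≤ R i)
    (hC : ∀ j, ∑ i ∈ univ.erase j, ‖M i j‖ ≤ C j) {γ : ℝ} (hγ : γ ∈ Set.Icc (0 : ℝ) 1) :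
    ∃ i j, i ≠ j ∧ ‖M i i‖ * ‖M j j‖ ≤ (R i * R j) ^ γ * (C i * C j) ^ (1 - γ) := by
  rcases hγ.2.eq_or_lt with rfl | hγ1
  -- For `γ = 1`, transpose and use exponent `0`: the new row bounds then enter only as a zeroth
  -- power, so they need only be enlarged to be positive.
  · obtain ⟨i, j, hij, h⟩ := exists_diag_mul_le_of_pos (M := M.transpose) (γ := 0)
      (by rw [Matrix.det_transpose, hM]) (R := fun i => max (C i) 1) (C := R)
      (fun i => by positivity) (fun i => (hC i).trans (le_max_left _ _)) hR le_rfl one_pos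
    exact ⟨i, j, hij, by simpa using h⟩
  by_contra! hcon
  -- Zero row bounds are handled by perturbing `R` to `R + ε`; the strict inequalities survive for
  -- small `ε`, simultaneously for the finitely many pairs.
  have hev : ∀ i j, i ≠ j → ∀ᶠ ε in nhdsWithin (0 : ℝ) (Set.Ioi 0),
      ((R i + ε) * (R j + ε)) ^ γ * (C i * C j) ^ (1 - γ) < ‖M i i‖ * ‖M j j‖ := by
    intro i j hij
    have hc : Continuous fun ε : ℝ => ((R i + ε) * (R j + ε)) ^ γ * (C i * C j) ^ (1 - γ) :=
      (Continuous.rpow_const (by fun_prop) fun _ => Or.inr hγ.1).mul continuous_const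
    refine (hc.tendsto 0).mono_left nhdsWithin_le_nhds |>.eventually_lt_const ?_
    simpa using hcon i j hij
  have hev' : ∀ᶠ ε in nhdsWithin (0 : ℝ) (Set.Ioi 0), 0 < ε ∧ ∀ i j, i ≠ j →
      ((R i + ε) * (R j + ε)) ^ γ * (C i * C j) ^ (1 - γ) < ‖M i i‖ * ‖M j j‖ := by
    refine (eventually_mem_nhdsWithin).and ?_
    simp only [Filter.eventually_all]
    exact hev
  obtain ⟨ε, hε, hlt⟩ := hev'.exists
  obtain ⟨i, j, hij, h⟩ := exists_diag_mul_le_of_pos hM (R := fun i => R i + ε) (C := C)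
    (fun i => by linarith [(sum_nonneg fun j _ => norm_nonneg (M i j)).trans (hR i)])
    (fun i => by linarith [hR i]) hC hγ.1 hγ1
  exact absurd h (not_le.mpr (hlt i j hij))

end Ostrowski

/-! ### Weighted geometric and arithmetic means. -/

section WeightedMeans

variable {a b c d α β : ℝ}

lemma one_sub_mem_Icc (hα : α ∈ Set.Icc (0 : ℝ) 1) : 1 - α ∈ Set.Icc (0 : ℝ) 1 :=
  ⟨by linarith [hα.2], by linarith [hα.1]⟩

lemma geom_le_arith (ha : 0 ≤ a) (hb : 0 ≤ b) (hα : α ∈ Set.Icc (0 : ℝ) 1) :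
    a ^ α * b ^ (1 - α) ≤ α * a + (1 - α) * b :=
  Real.geom_mean_le_arith_mean2_weighted hα.1 (one_sub_mem_Icc hα).1 ha hb (by ring)

lemma geom_nonneg (ha : 0 ≤ a) (hb : 0 ≤ b) : 0 ≤ a ^ α * b ^ β := by positivity

lemma geom_mono (ha : 0 ≤ a) (hb : 0 ≤ b) (hac : a ≤ c) (hbd : b ≤ d)
    (hα : α ∈ Set.Icc (0 : ℝ) 1) : a ^ α * b ^ (1 - α) ≤ c ^ α * d ^ (1 - α) :=
  mul_le_mul (Real.rpow_le_rpow ha hac hα.1) (Real.rpow_le_rpow hb hbd (one_sub_mem_Icc hα).1)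
    (Real.rpow_nonneg hb _) (Real.rpow_nonneg (ha.trans hac) _)

/-- Interchanging the `α`-mean over the two indices with the `β`-mean over rows and columns lets
AM-GM act on either one, as kinds 24, 25, 30 and 31 require. -/
lemma geom_geom (ha : 0 ≤ a) (hb : 0 ≤ b) (hc : 0 ≤ c) (hd : 0 ≤ d) :
    (a ^ β * b ^ (1 - β)) ^ α * (c ^ β * d ^ (1 - β)) ^ (1 - α)
      = (a ^ α * c ^ (1 - α)) ^ β * (b ^ α * d ^ (1 - α)) ^ (1 - β) := by
  rw [Real.mul_rpow (by positivity) (by positivity), Real.mul_rpow (by positivity) (by positivity),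
    Real.mul_rpow (by positivity) (by positivity), Real.mul_rpow (by positivity) (by positivity)]
  simp only [← Real.rpow_mul, ha, hb, hc, hd]
  rw [mul_comm β α, mul_comm (1 - β) α, mul_comm β (1 - α), mul_comm (1 - β) (1 - α)]
  ring

lemma geom_half : a ^ (1 / 2 : ℝ) * b ^ (1 - 1 / 2 : ℝ) = √a * √b := by
  rw [Real.sqrt_eq_rpow, Real.sqrt_eq_rpow]
  norm_num

lemma mul_le_mul_of_geom_half_le (ha : 0 ≤ a) (hc : 0 ≤ c) (hd : 0 ≤ d)
    (h : a ^ (1 / 2 : ℝ) * b ^ (1 - 1 / 2 : ℝ) ≤ c ^ (1 / 2 : ℝ) * d ^ (1 - 1 / 2 : ℝ)) :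
    a * b ≤ c * d := by
  rwa [geom_half, geom_half, ← Real.sqrt_mul ha, ← Real.sqrt_mul hc,
    Real.sqrt_le_sqrt_iff (mul_nonneg hc hd)] at h

lemma rpow_mul_rpow_one_sub (ha : 0 ≤ a) (hα : α ∈ Set.Icc (0 : ℝ) 1) :
    a ^ α * a ^ (1 - α) = a := by
  rw [← Real.rpow_add_of_nonneg ha hα.1 (one_sub_mem_Icc hα).1, add_sub_cancel, Real.rpow_one]

lemma geom_mul_geom_swap (ha : 0 ≤ a) (hb : 0 ≤ b) (hα : α ∈ Set.Icc (0 : ℝ) 1) :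
    (a ^ α * b ^ (1 - α)) * (b ^ α * a ^ (1 - α)) = a * b :=
  calc _ = (a ^ α * a ^ (1 - α)) * (b ^ α * b ^ (1 - α)) := by ring
    _ = a * b := by rw [rpow_mul_rpow_one_sub ha hα, rpow_mul_rpow_one_sub hb hα]

end WeightedMeans

/-! ### From kind 8 to kinds 22 and 23. -/

section Kinds

variable {ι : Type*} {x r c : ι → ℝ}

/-- The inequalities of kind `22` follow from those of kind `8`. -/
lemma exists_geom_le (hx : ∀ i, 0 ≤ x i) (hr : ∀ i, 0 ≤ r i) (hc : ∀ i, 0 ≤ c i)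
    (h8 : ∀ γ ∈ Set.Icc (0 : ℝ) 1, ∃ i j, i ≠ j ∧
      x i * x j ≤ (r i * r j) ^ γ * (c i * c j) ^ (1 - γ))
    {α β : ℝ} (hα : α ∈ Set.Icc (0 : ℝ) 1) (hβ : β ∈ Set.Icc (0 : ℝ) 1) :
    ∃ i j, i ≠ j ∧ x i ^ α * x j ^ (1 - α) ≤
      (r i ^ β * c i ^ (1 - β)) ^ α * (r j ^ β * c j ^ (1 - β)) ^ (1 - α) := by
  by_contra! hcon
  obtain ⟨i, j, hij, h⟩ := h8 β hβ
  have h' := mul_lt_mul'' (hcon i j hij) (hcon j i hij.symm)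
    (geom_nonneg (geom_nonneg (hr _) (hc _)) (geom_nonneg (hr _) (hc _)))
    (geom_nonneg (geom_nonneg (hr _) (hc _)) (geom_nonneg (hr _) (hc _)))
  rw [geom_mul_geom_swap (hx i) (hx j) hα,
    geom_mul_geom_swap (geom_nonneg (hr _) (hc _)) (geom_nonneg (hr _) (hc _)) hα] at h'
  rw [Real.mul_rpow (hr i) (hr j), Real.mul_rpow (hc i) (hc j)] at h
  linarith

/-- The inequalities of kind `23` follow from those of kind `8`. -/
lemma exists_geom_cross_le (hx : ∀ i, 0 ≤ x i) (hr : ∀ i, 0 ≤ r i) (hc : ∀ i, 0 ≤ c i)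
    (h8 : ∀ γ ∈ Set.Icc (0 : ℝ) 1, ∃ i j, i ≠ j ∧
      x i * x j ≤ (r i * r j) ^ γ * (c i * c j) ^ (1 - γ))
    {α β : ℝ} (hα : α ∈ Set.Icc (0 : ℝ) 1) (hβ : β ∈ Set.Icc (0 : ℝ) 1) :
    ∃ i j, i ≠ j ∧ x i ^ α * x j ^ (1 - α) ≤
      (r i ^ β * c i ^ (1 - β)) ^ α * (c j ^ β * r j ^ (1 - β)) ^ (1 - α) := by
  by_contra! hcon
  have hα' := one_sub_mem_Icc hα
  have hβ' := one_sub_mem_Icc hβ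
  -- This `γ` is the total exponent of `r i`, and equally of `r j`, in the product of the right-hand
  -- sides for `(i, j)` and `(j, i)`.
  obtain ⟨i, j, hij, h⟩ := h8 (β * α + (1 - β) * (1 - α))
    ⟨add_nonneg (mul_nonneg hβ.1 hα.1) (mul_nonneg hβ'.1 hα'.1),
      by nlinarith [hα.1, hα.2, hβ.1, hβ.2, mul_nonneg hβ.1 hα'.1, mul_nonneg hβ'.1 hα.1]⟩
  have h' := mul_lt_mul'' (hcon i j hij) (hcon j i hij.symm)
    (geom_nonneg (geom_nonneg (hr _) (hc _)) (geom_nonneg (hc _) (hr _)))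
    (geom_nonneg (geom_nonneg (hr _) (hc _)) (geom_nonneg (hc _) (hr _)))
  rw [geom_mul_geom_swap (hx i) (hx j) hα] at h'
  refine absurd h (not_le.mpr (lt_of_eq_of_lt ?_ h'))
  have e : 1 - (β * α + (1 - β) * (1 - α)) = (1 - β) * α + β * (1 - α) := by ring
  have n1 := mul_nonneg hβ.1 hα.1
  have n2 := mul_nonneg hβ'.1 hα'.1
  have n3 := mul_nonneg hβ'.1 hα.1
  have n4 := mul_nonneg hβ.1 hα'.1
  have split : ∀ {a b : ℝ}, 0 ≤ a → 0 ≤ b → ∀ s t : ℝ, (a ^ s * b ^ t) ^ α =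
      a ^ (s * α) * b ^ (t * α) ∧ (a ^ s * b ^ t) ^ (1 - α) =
      a ^ (s * (1 - α)) * b ^ (t * (1 - α)) := fun {a b} ha hb s t => by
    constructor <;>
    rw [Real.mul_rpow (by positivity) (by positivity), ← Real.rpow_mul ha, ← Real.rpow_mul hb]
  rw [e, Real.mul_rpow (hr i) (hr j), Real.mul_rpow (hc i) (hc j),
    Real.rpow_add_of_nonneg (hr i) n1 n2, Real.rpow_add_of_nonneg (hr j) n1 n2,
    Real.rpow_add_of_nonneg (hc i) n3 n4, Real.rpow_add_of_nonneg (hc j) n3 n4,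
    (split (hr i) (hc i) _ _).1, (split (hr j) (hc j) _ _).1, (split (hc i) (hr i) _ _).2,
    (split (hc j) (hr j) _ _).2]
  ring

end Kinds

variable {n : ℕ}

/-! ### From kinds 22 and 23 to every kind. -/

/-- A point lying in all the sets of the kinds `22` and `23` lies in the sets of every kind. -/
lemma mem_of_mem_geom {A : Matrix (Fin n) (Fin n) ℂ} {r c : Fin n → ℝ}
    (hr : ∀ i, 0 ≤ r i) (hc : ∀ i, 0 ≤ c i) {z : ℂ}
    (h22 : ∀ α ∈ Set.Icc (0 : ℝ) 1, ∀ β ∈ Set.Icc (0 : ℝ) 1, ∃ i j, i ≠ j ∧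
      z ∈ oval 22 A r c α β i j)
    (h23 : ∀ α ∈ Set.Icc (0 : ℝ) 1, ∀ β ∈ Set.Icc (0 : ℝ) 1, ∃ i j, i ≠ j ∧
      z ∈ oval 23 A r c α β i j)
    {α β : ℝ} (hα : α ∈ Set.Icc (0 : ℝ) 1) (hβ : β ∈ Set.Icc (0 : ℝ) 1) :
    (∀ k ∈ Icc (1 : ℕ) 4, ∃ i, z ∈ disk k A r c α i) ∧
      ∀ k ∈ Icc (5 : ℕ) 31, ∃ i j, i ≠ j ∧ z ∈ oval k A r c α β i j := by
  simp only [oval, ovalRadius, Nat.reduceLeDiff, if_false, Set.mem_ofPred_eq] at h22 h23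
  have m0 : (0 : ℝ) ∈ Set.Icc (0 : ℝ) 1 := by simp
  have m1 : (1 : ℝ) ∈ Set.Icc (0 : ℝ) 1 := by simp
  have mh : (1 / 2 : ℝ) ∈ Set.Icc (0 : ℝ) 1 := by constructor <;> norm_num
  have grc : ∀ i (s t : ℝ), 0 ≤ r i ^ s * c i ^ t := fun i s t => geom_nonneg (hr i) (hc i)
  have gcr : ∀ i (s t : ℝ), 0 ≤ c i ^ s * r i ^ t := fun i s t => geom_nonneg (hc i) (hr i)
  -- At `α = 1/2` both sides are square roots; squaring gives product ovals, with `β` left free to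
  -- play the role of `α` in kinds 5 to 15.
  have p22 : ∀ β ∈ Set.Icc (0 : ℝ) 1, ∃ i j, i ≠ j ∧ ‖z - A i i‖ * ‖z - A j j‖ ≤
      (r i ^ β * c i ^ (1 - β)) * (r j ^ β * c j ^ (1 - β)) := fun β hβ => by
    obtain ⟨i, j, hij, h⟩ := h22 _ mh β hβ
    exact ⟨i, j, hij, mul_le_mul_of_geom_half_le (norm_nonneg _) (grc _ _ _)
      (grc _ _ _) h⟩
  have p23 : ∀ β ∈ Set.Icc (0 : ℝ) 1, ∃ i j, i ≠ j ∧ ‖z - A i i‖ * ‖z - A j j‖ ≤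
      (r i ^ β * c i ^ (1 - β)) * (c j ^ β * r j ^ (1 - β)) := fun β hβ => by
    obtain ⟨i, j, hij, h⟩ := h23 _ mh β hβ
    exact ⟨i, j, hij, mul_le_mul_of_geom_half_le (norm_nonneg _) (grc _ _ _)
      (gcr _ _ _) h⟩
  have hα' := (one_sub_mem_Icc hα).1
  have hβ' := (one_sub_mem_Icc hβ).1
  have am : ∀ {a b : ℝ}, 0 ≤ a → 0 ≤ b → a ^ α * b ^ (1 - α) ≤ α * a + (1 - α) * b :=
    fun ha hb => geom_le_arith ha hb hα
  have bm : ∀ {a b : ℝ}, 0 ≤ a → 0 ≤ b → a ^ β * b ^ (1 - β) ≤ β * a + (1 - β) * b :=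
    fun ha hb => geom_le_arith ha hb hβ
  have amm : ∀ {a b c d : ℝ}, 0 ≤ a → 0 ≤ b → 0 ≤ c → 0 ≤ d →
      (a ^ α * b ^ (1 - α)) * (c ^ α * d ^ (1 - α)) ≤
        (α * a + (1 - α) * b) * (α * c + (1 - α) * d) := fun {a b c d} ha hb hc hd =>
    mul_le_mul (am ha hb) (am hc hd) (geom_nonneg hc hd)
      (add_nonneg (mul_nonneg hα.1 ha) (mul_nonneg hα' hb))
  refine ⟨fun k hk => ?_, fun k hk => ?_⟩
  · have h3 : ∀ α ∈ Set.Icc (0 : ℝ) 1, ∃ i, ‖z - A i i‖ ≤ r i ^ α * c i ^ (1 - α) := fun α hα => by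
      -- At `α = 1` the factors belonging to `j` have exponent `0` and equal `1`, even when the base
      -- is `0`, so the oval becomes a disk.
      obtain ⟨i, j, -, h⟩ := h22 1 m1 α hα
      exact ⟨i, by simpa using h⟩
    obtain ⟨hk1, hk4⟩ := mem_Icc.mp hk
    simp only [disk, Set.mem_ofPred_eq]
    interval_cases k <;> simp only [diskRadius]
    · obtain ⟨i, h⟩ := h3 1 m1
      exact ⟨i, by simpa using h⟩
    · obtain ⟨i, h⟩ := h3 0 m0
      exact ⟨i, by simpa using h⟩
    · exact h3 α hα
    · obtain ⟨i, h⟩ := h3 α hα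
      exact ⟨i, h.trans (am (hr i) (hc i))⟩
  · obtain ⟨hk5, hk31⟩ := mem_Icc.mp hk
    simp only [oval]
    interval_cases k <;>
      simp only [ovalRadius, Nat.reduceLeDiff, if_false, if_true, Set.mem_ofPred_eq]
    · obtain ⟨i, j, hij, h⟩ := p22 1 m1
      exact ⟨i, j, hij, by simpa using h⟩
    · obtain ⟨i, j, hij, h⟩ := p22 0 m0
      exact ⟨i, j, hij, by simpa using h⟩
    · obtain ⟨i, j, hij, h⟩ := p23 1 m1
      exact ⟨i, j, hij, by simpa using h⟩
    · obtain ⟨i, j, hij, h⟩ := p22 α hα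
      refine ⟨i, j, hij, h.trans_eq ?_⟩
      rw [Real.mul_rpow (hr i) (hr j), Real.mul_rpow (hc i) (hc j)]
      ring
    · obtain ⟨i, j, hij, h⟩ := p23 α hα
      refine ⟨i, j, hij, h.trans_eq ?_⟩
      rw [Real.mul_rpow (hr i) (hc j), Real.mul_rpow (hr j) (hc i)]
      ring
    · obtain ⟨i, j, hij, h⟩ := p22 α hα
      refine ⟨i, j, hij, h.trans (le_of_eq_of_le ?_
        (am (mul_nonneg (hr i) (hr j)) (mul_nonneg (hc i) (hc j))))⟩
      rw [Real.mul_rpow (hr i) (hr j), Real.mul_rpow (hc i) (hc j)]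
      ring
    · obtain ⟨i, j, hij, h⟩ := p23 α hα
      refine ⟨i, j, hij, h.trans (le_of_eq_of_le ?_
        (am (mul_nonneg (hr i) (hc j)) (mul_nonneg (hr j) (hc i))))⟩
      rw [Real.mul_rpow (hr i) (hc j), Real.mul_rpow (hr j) (hc i)]
      ring
    · obtain ⟨i, j, hij, h⟩ := p22 α hα
      exact ⟨i, j, hij, h.trans (amm (hr i) (hc i) (hr j) (hc j))⟩
    · obtain ⟨i, j, hij, h⟩ := p23 α hα
      exact ⟨i, j, hij, h.trans (amm (hr i) (hc i) (hc j) (hr j))⟩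
    · obtain ⟨i, j, hij, h⟩ := p22 α hα
      -- The four factors are regrouped as `r i` with `c j` and `r j` with `c i` before AM-GM.
      exact ⟨i, j, hij, h.trans (le_of_eq_of_le (by ring) (amm (hr i) (hc j) (hr j) (hc i)))⟩
    · obtain ⟨i, j, hij, h⟩ := p23 α hα
      exact ⟨i, j, hij, h.trans (le_of_eq_of_le (by ring) (amm (hr i) (hr j) (hc j) (hc i)))⟩
    · obtain ⟨i, j, hij, h⟩ := h22 α hα 1 m1
      exact ⟨i, j, hij, by simpa using h⟩
    · obtain ⟨i, j, hij, h⟩ := h22 α hα 0 m0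
      exact ⟨i, j, hij, by simpa using h⟩
    · obtain ⟨i, j, hij, h⟩ := h23 α hα 1 m1
      exact ⟨i, j, hij, by simpa using h⟩
    · obtain ⟨i, j, hij, h⟩ := h22 α hα 1 m1
      exact ⟨i, j, hij, le_trans (by simpa using h) (am (hr i) (hr j))⟩
    · obtain ⟨i, j, hij, h⟩ := h22 α hα 0 m0
      exact ⟨i, j, hij, le_trans (by simpa using h) (am (hc i) (hc j))⟩
    · obtain ⟨i, j, hij, h⟩ := h23 α hα 1 m1
      exact ⟨i, j, hij, le_trans (by simpa using h) (am (hr i) (hc j))⟩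
    · exact h22 α hα β hβ
    · exact h23 α hα β hβ
    · obtain ⟨i, j, hij, h⟩ := h22 α hα β hβ
      rw [geom_geom (hr i) (hc i) (hr j) (hc j)] at h
      exact ⟨i, j, hij, h.trans (bm (geom_nonneg (hr i) (hr j)) (geom_nonneg (hc i) (hc j)))⟩
    · obtain ⟨i, j, hij, h⟩ := h23 α hα β hβ
      rw [geom_geom (hr i) (hc i) (hc j) (hr j)] at h
      exact ⟨i, j, hij, h.trans (bm (geom_nonneg (hr i) (hc j)) (geom_nonneg (hc i) (hr j)))⟩
    · obtain ⟨i, j, hij, h⟩ := h22 α hα β hβ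
      exact ⟨i, j, hij, h.trans (am (grc _ _ _) (grc _ _ _))⟩
    · obtain ⟨i, j, hij, h⟩ := h23 α hα β hβ
      exact ⟨i, j, hij, h.trans (am (grc _ _ _) (gcr _ _ _))⟩
    · obtain ⟨i, j, hij, h⟩ := h22 α hα β hβ
      exact ⟨i, j, hij, h.trans (geom_mono (grc _ _ _) (grc _ _ _) (bm (hr i) (hc i))
        (bm (hr j) (hc j)) hα)⟩
    · obtain ⟨i, j, hij, h⟩ := h23 α hα β hβ
      exact ⟨i, j, hij, h.trans (geom_mono (grc _ _ _) (gcr _ _ _) (bm (hr i) (hc i))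
        (bm (hc j) (hr j)) hα)⟩
    · obtain ⟨i, j, hij, h⟩ := h22 α hα β hβ
      rw [geom_geom (hr i) (hc i) (hr j) (hc j)] at h
      exact ⟨i, j, hij, h.trans (geom_mono (geom_nonneg (hr i) (hr j))
        (geom_nonneg (hc i) (hc j)) (am (hr i) (hr j)) (am (hc i) (hc j)) hβ)⟩
    · obtain ⟨i, j, hij, h⟩ := h23 α hα β hβ
      rw [geom_geom (hr i) (hc i) (hc j) (hr j)] at h
      exact ⟨i, j, hij, h.trans (geom_mono (geom_nonneg (hr i) (hc j))
        (geom_nonneg (hc i) (hr j)) (am (hr i) (hc j)) (am (hc i) (hr j)) hβ)⟩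

/-! ### Unions over indices and intersections over parameters. -/

lemma mem_region_of_five_le {k : ℕ} (hk : 5 ≤ k) {A : Matrix (Fin n) (Fin n) ℂ} {r c : Fin n → ℝ}
    {α β : ℝ} {z : ℂ} :
    z ∈ region k A r c α β ↔ ∃ i j, i ≠ j ∧ z ∈ oval k A r c α β i j := by
  simp [region, show ¬ k ≤ 4 by omega]

lemma mem_region_of_kinds {A : Matrix (Fin n) (Fin n) ℂ} {r c : Fin n → ℝ} {α β : ℝ} {z : ℂ}
    (h : (∀ k ∈ Icc (1 : ℕ) 4, ∃ i, z ∈ disk k A r c α i) ∧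
      ∀ k ∈ Icc (5 : ℕ) 31, ∃ i j, i ≠ j ∧ z ∈ oval k A r c α β i j)
    {k : ℕ} (hk : k ∈ Icc (1 : ℕ) 31) : z ∈ region k A r c α β := by
  obtain ⟨hk1, hk31⟩ := mem_Icc.mp hk
  rcases le_or_gt k 4 with hk4 | hk4
  · simpa [region, hk4] using h.1 k (mem_Icc.mpr ⟨hk1, hk4⟩)
  · exact (mem_region_of_five_le hk4).mpr (h.2 k (mem_Icc.mpr ⟨hk4, hk31⟩))

lemma mem_boldRegion {k : ℕ} {A : Matrix (Fin n) (Fin n) ℂ} {r c : Fin n → ℝ} {z : ℂ} :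
    z ∈ boldRegion k A r c ↔ ∀ α ∈ Set.Icc (0 : ℝ) 1, ∀ β ∈ Set.Icc (0 : ℝ) 1,
      z ∈ region k A r c α β := by
  simp only [boldRegion, Set.mem_iInter]

/-- All the inclusions follow from the Ostrowski–Brauer ovals, the kind `8`. -/
theorem inclusions_of_ostrowski {A : Matrix (Fin n) (Fin n) ℂ} {r c : Fin n → ℝ}
    (hr : ∀ i, 0 ≤ r i) (hc : ∀ i, 0 ≤ c i)
    (h8 : ∀ z ∈ spectrum ℂ A, ∀ γ ∈ Set.Icc (0 : ℝ) 1, ∃ i j, i ≠ j ∧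
      ‖z - A i i‖ * ‖z - A j j‖ ≤ (r i * r j) ^ γ * (c i * c j) ^ (1 - γ)) :
    (∀ α ∈ Set.Icc (0 : ℝ) 1, ∀ β ∈ Set.Icc (0 : ℝ) 1, ∀ z ∈ spectrum ℂ A,
        (∀ k ∈ Icc (1 : ℕ) 4, ∃ i : Fin n, z ∈ disk k A r c α i) ∧
        (∀ k ∈ Icc (5 : ℕ) 31, ∃ i j : Fin n, i ≠ j ∧ z ∈ oval k A r c α β i j)) ∧
      (∀ k ∈ Icc (1 : ℕ) 31,
        spectrum ℂ A ⊆ boldRegion k A r c ∧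
        ∀ α ∈ Set.Icc (0 : ℝ) 1, ∀ β ∈ Set.Icc (0 : ℝ) 1,
          boldRegion k A r c ⊆ region k A r c α β) ∧
      spectrum ℂ A ⊆ (⋂ k ∈ Icc (1 : ℕ) 31, boldRegion k A r c) ∧
      (⋂ k ∈ Icc (1 : ℕ) 31, boldRegion k A r c) =
        boldRegion 22 A r c ∩ boldRegion 23 A r c := by
  have hall : ∀ α ∈ Set.Icc (0 : ℝ) 1, ∀ β ∈ Set.Icc (0 : ℝ) 1, ∀ z ∈ spectrum ℂ A,
      (∀ k ∈ Icc (1 : ℕ) 4, ∃ i : Fin n, z ∈ disk k A r c α i) ∧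
      (∀ k ∈ Icc (5 : ℕ) 31, ∃ i j : Fin n, i ≠ j ∧ z ∈ oval k A r c α β i j) := by
    intro α hα β hβ z hz
    refine mem_of_mem_geom hr hc (fun α hα β hβ => ?_) (fun α hα β hβ => ?_) hα hβ
    · simpa [oval, ovalRadius] using
        exists_geom_le (fun i => norm_nonneg (z - A i i)) hr hc (h8 z hz) hα hβ
    · simpa [oval, ovalRadius] using
        exists_geom_cross_le (fun i => norm_nonneg (z - A i i)) hr hc (h8 z hz) hα hβ
  have hbold : ∀ k ∈ Icc (1 : ℕ) 31, spectrum ℂ A ⊆ boldRegion k A r c := fun k hk z hz =>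
    mem_boldRegion.mpr fun α hα β hβ => mem_region_of_kinds (hall α hα β hβ z hz) hk
  refine ⟨hall, fun k hk => ⟨hbold k hk, fun α hα β hβ z hz => mem_boldRegion.mp hz α hα β hβ⟩,
    Set.subset_iInter₂ hbold, Set.Subset.antisymm ?_ ?_⟩
  · exact Set.subset_inter (Set.iInter₂_subset 22 (by simp)) (Set.iInter₂_subset 23 (by simp))
  · rintro z ⟨h22, h23⟩
    refine Set.mem_iInter₂.mpr fun k hk => mem_boldRegion.mpr fun α hα β hβ =>
      mem_region_of_kinds (mem_of_mem_geom hr hc ?_ ?_ hα hβ) hk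
    · exact fun α hα β hβ => (mem_region_of_five_le (by norm_num)).mp
        (mem_boldRegion.mp h22 α hα β hβ)
    · exact fun α hα β hβ => (mem_region_of_five_le (by norm_num)).mp
        (mem_boldRegion.mp h23 α hα β hβ)

/-! ### Eigenvalues of the full matrix and of its diagonal blocks. -/

lemma det_sub_eq_zero_of_mem_spectrum {m : Type*} [Fintype m] [DecidableEq m]
    {A : Matrix m m ℂ} {z : ℂ} (hz : z ∈ spectrum ℂ A) : (Matrix.scalar m z - A).det = 0 := by
  by_contra h
  exact hz ((Matrix.isUnit_iff_isUnit_det _).mpr (isUnit_iff_ne_zero.mpr h))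

lemma norm_scalar_sub_of_ne {m : Type*} [Fintype m] [DecidableEq m] (A : Matrix m m ℂ) (z : ℂ)
    {i j : m} (h : i ≠ j) : ‖(Matrix.scalar m z - A) i j‖ = ‖A i j‖ := by
  simp [Matrix.sub_apply, h]

lemma ostrowski_of_mem_spectrum (hn : 2 ≤ n) {A : Matrix (Fin n) (Fin n) ℂ} {z : ℂ}
    (hz : z ∈ spectrum ℂ A) {γ : ℝ} (hγ : γ ∈ Set.Icc (0 : ℝ) 1) :
    ∃ i j, i ≠ j ∧ ‖z - A i i‖ * ‖z - A j j‖ ≤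
      (rowSum A i * rowSum A j) ^ γ * (colSum A i * colSum A j) ^ (1 - γ) := by
  have : Nontrivial (Fin n) := Fin.nontrivial_iff_two_le.mpr hn
  simpa using exists_diag_mul_le (det_sub_eq_zero_of_mem_spectrum hz) (R := rowSum A)
    (C := colSum A)
    (fun i => (sum_congr rfl fun j hj =>
      norm_scalar_sub_of_ne A z (ne_of_mem_erase hj).symm).le)
    (fun j => (sum_congr rfl fun i hi =>
      norm_scalar_sub_of_ne A z (ne_of_mem_erase hi)).le) hγ

lemma sum_erase_subtype {m κ : Type*} [Fintype m] [DecidableEq m] [DecidableEq κ] (b : m → κ)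
    (k : κ) (i : {a // b a = k}) (f : m → ℝ) :
    ∑ j ∈ univ.erase i, f j = ∑ j with j ≠ i.1 ∧ b j = b i.1, f j := by
  refine sum_bij' (fun j _ => j.1) (fun j hj => ⟨j, ((mem_filter.mp hj).2.2).trans i.2⟩)
    ?_ ?_ ?_ ?_ ?_
  · intro j hj
    simp only [mem_filter, mem_univ, true_and]
    exact ⟨fun h => ne_of_mem_erase hj (Subtype.ext h), j.2.trans i.2.symm⟩
  · intro j hj
    simp only [mem_erase, mem_univ, and_true, ne_eq, Subtype.ext_iff]
    exact (mem_filter.mp hj).2.1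
  all_goals simp

lemma ostrowski_of_mem_spectrum_of_blockTriangular (hn : 2 ≤ n) {A : Matrix (Fin n) (Fin n) ℂ}
    {l : ℕ} {b : Fin n → Fin l} (hb : A.BlockTriangular b) {z : ℂ}
    (hz : z ∈ spectrum ℂ A) {γ : ℝ} (hγ : γ ∈ Set.Icc (0 : ℝ) 1) :
    ∃ i j, i ≠ j ∧ ‖z - A i i‖ * ‖z - A j j‖ ≤
      (blockRowSum A b i * blockRowSum A b j) ^ γ *
        (blockColSum A b i * blockColSum A b j) ^ (1 - γ) := by
  have : Nontrivial (Fin n) := Fin.nontrivial_iff_two_le.mpr hn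
  have hr : ∀ i, 0 ≤ blockRowSum A b i := fun i => sum_nonneg fun j _ => norm_nonneg _
  have hc : ∀ i, 0 ≤ blockColSum A b i := fun i => sum_nonneg fun j _ => norm_nonneg _
  have hM : (Matrix.scalar (Fin n) z - A).BlockTriangular b :=
    (Matrix.blockTriangular_diagonal _).sub hb
  have hdet := det_sub_eq_zero_of_mem_spectrum hz
  rw [hM.det_fintype, prod_eq_zero_iff] at hdet
  obtain ⟨k, -, hk⟩ := hdet
  -- A singular block of order one means `z = A i i`; the left side then vanishes, and any other
  -- index, from whichever block, serves as `j`.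
  cases subsingleton_or_nontrivial {a // b a = k}
  · cases isEmpty_or_nonempty {a // b a = k}
    · simp at hk
    · obtain ⟨i⟩ := ‹Nonempty {a // b a = k}›
      rw [Matrix.det_eq_elem_of_subsingleton _ i] at hk
      have hi : z - A i i = 0 := by simpa [Matrix.toSquareBlock_def] using hk
      obtain ⟨j, hj⟩ := exists_ne i.1
      refine ⟨i, j, hj.symm, ?_⟩
      rw [hi, norm_zero, zero_mul]
      exact geom_nonneg (mul_nonneg (hr _) (hr _)) (mul_nonneg (hc _) (hc _))
  · have hR : ∀ i : {a // b a = k}, ∑ j ∈ univ.erase i,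
        ‖(Matrix.scalar (Fin n) z - A).toSquareBlock b k i j‖ ≤ blockRowSum A b i := fun i => by
      rw [blockRowSum, ← sum_erase_subtype b k i fun j => ‖A i j‖]
      exact (sum_congr rfl fun j hj => norm_scalar_sub_of_ne A z
        fun h => ne_of_mem_erase hj (Subtype.ext h.symm)).le
    have hC : ∀ j : {a // b a = k}, ∑ i ∈ univ.erase j,
        ‖(Matrix.scalar (Fin n) z - A).toSquareBlock b k i j‖ ≤ blockColSum A b j := fun j => by
      rw [blockColSum, ← sum_erase_subtype b k j fun i => ‖A i j‖]
      exact (sum_congr rfl fun i hi => norm_scalar_sub_of_ne A z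
        fun h => ne_of_mem_erase hi (Subtype.ext h)).le
    obtain ⟨i, j, hij, h⟩ := exists_diag_mul_le hk hR hC hγ
    exact ⟨i, j, fun h => hij (Subtype.ext h), by simpa [Matrix.toSquareBlock_def] using h⟩

end EigenInclusion

theorem theorem5p7 {n : ℕ} (hn : 2 ≤ n) (A : Matrix (Fin n) (Fin n) ℂ) :
    -- the sets built from the ordinary deleted row and column sums
    ((∀ α ∈ Set.Icc (0 : ℝ) 1, ∀ β ∈ Set.Icc (0 : ℝ) 1, ∀ z ∈ spectrum ℂ A,
        (∀ k ∈ Finset.Icc (1 : ℕ) 4, ∃ i : Fin n,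
          z ∈ EigenInclusion.disk k A (EigenInclusion.rowSum A) (EigenInclusion.colSum A) α i) ∧
        (∀ k ∈ Finset.Icc (5 : ℕ) 31, ∃ i j : Fin n, i ≠ j ∧
          z ∈ EigenInclusion.oval k A
            (EigenInclusion.rowSum A) (EigenInclusion.colSum A) α β i j)) ∧
      (∀ k ∈ Finset.Icc (1 : ℕ) 31,
        spectrum ℂ A ⊆
          EigenInclusion.boldRegion k A (EigenInclusion.rowSum A) (EigenInclusion.colSum A) ∧
        ∀ α ∈ Set.Icc (0 : ℝ) 1, ∀ β ∈ Set.Icc (0 : ℝ) 1,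
          EigenInclusion.boldRegion k A (EigenInclusion.rowSum A) (EigenInclusion.colSum A) ⊆
            EigenInclusion.region k A
              (EigenInclusion.rowSum A) (EigenInclusion.colSum A) α β) ∧
      spectrum ℂ A ⊆ (⋂ k ∈ Finset.Icc (1 : ℕ) 31,
        EigenInclusion.boldRegion k A (EigenInclusion.rowSum A) (EigenInclusion.colSum A)) ∧
      (⋂ k ∈ Finset.Icc (1 : ℕ) 31,
        EigenInclusion.boldRegion k A (EigenInclusion.rowSum A) (EigenInclusion.colSum A)) =
        EigenInclusion.boldRegion 22 A (EigenInclusion.rowSum A) (EigenInclusion.colSum A) ∩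
          EigenInclusion.boldRegion 23 A
            (EigenInclusion.rowSum A) (EigenInclusion.colSum A)) ∧
    -- the analogue for the sums inside the diagonal blocks of a Frobenius normal form
    (∀ (l : ℕ) (b : Fin n → Fin l), EigenInclusion.IsFrobeniusForm A b →
      ∀ rt ct : Fin n → ℝ,
        rt = EigenInclusion.blockRowSum A b → ct = EigenInclusion.blockColSum A b →
        (∀ α ∈ Set.Icc (0 : ℝ) 1, ∀ β ∈ Set.Icc (0 : ℝ) 1, ∀ z ∈ spectrum ℂ A,
          (∀ k ∈ Finset.Icc (1 : ℕ) 4, ∃ i : Fin n, z ∈ EigenInclusion.disk k A rt ct α i) ∧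
          (∀ k ∈ Finset.Icc (5 : ℕ) 31, ∃ i j : Fin n, i ≠ j ∧
            z ∈ EigenInclusion.oval k A rt ct α β i j)) ∧
        (∀ k ∈ Finset.Icc (1 : ℕ) 31,
          spectrum ℂ A ⊆ EigenInclusion.boldRegion k A rt ct ∧
          ∀ α ∈ Set.Icc (0 : ℝ) 1, ∀ β ∈ Set.Icc (0 : ℝ) 1,
            EigenInclusion.boldRegion k A rt ct ⊆ EigenInclusion.region k A rt ct α β) ∧
        spectrum ℂ A ⊆ (⋂ k ∈ Finset.Icc (1 : ℕ) 31, EigenInclusion.boldRegion k A rt ct) ∧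
        (⋂ k ∈ Finset.Icc (1 : ℕ) 31, EigenInclusion.boldRegion k A rt ct) =
          EigenInclusion.boldRegion 22 A rt ct ∩ EigenInclusion.boldRegion 23 A rt ct) := by
  refine ⟨EigenInclusion.inclusions_of_ostrowski
    (fun i => Finset.sum_nonneg fun j _ => norm_nonneg _)
    (fun i => Finset.sum_nonneg fun j _ => norm_nonneg _)
    fun z hz γ hγ => EigenInclusion.ostrowski_of_mem_spectrum hn hz hγ, ?_⟩
  rintro l b hb rt ct rfl rfl
  exact EigenInclusion.inclusions_of_ostrowski
    (fun i => Finset.sum_nonneg fun j _ => norm_nonneg _)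
    (fun i => Finset.sum_nonneg fun j _ => norm_nonneg _)
    fun z hz γ hγ => EigenInclusion.ostrowski_of_mem_spectrum_of_blockTriangular hn
      hb.blockTriangular hz hγ
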